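/- Let $R$ be a commutative local ring (a ring with a unique maximal ideal, not assumed Noetherian) of Krull dimension $1$ with maximal ideal $M$, suppose that $M$ is regular (i.e. contains a nonzerodivisor), and let $m \in M$ be a nonzerodivisor. Let $\widetilde{R} = \varprojlim_n R/m^nR$ be the $mR$-adic completion of $R$. An ideal is called regular if it contains a nonzerodivisor, and two-generated if it can be generated by two elements. For a Noetherian local ring $(A,N)$ of Krull dimension $d$, the length of $A/N^n$ is, for all sufficiently large $n$, given by a polynomial in $n$ of degree $d$; the multiplicity of $A$ is $d!$ times the leading coefficient of this polynomial. Then the following statements are equivalent. 1. $M^n$ is two-generated for some $n \geq 2$. 2. $\widetilde{R}$ is a Noetherian local ring of multiplicity at most $2$. 3. Every regular ideal of $R$ is two-generated. -/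

import Mathlib

open scoped Nat

/-- An ideal is regular if it contains a nonzerodivisor. -/
def RegularIdeal {R : Type*} [CommRing R] (I : Ideal R) : Prop :=
  ∃ x ∈ I, x ∈ nonZeroDivisors R

/-- An ideal is two-generated if it can be generated by two (not necessarily distinct) elements. -/
def TwoGenerated {R : Type*} [CommRing R] (I : Ideal R) : Prop :=
  ∃ x y : R, I = Ideal.span {x, y}

/-- The local ring `A` with maximal ideal `M` has multiplicity `e`: there is a polynomial `p` of
degree `d = dim A` such that `A / M ^ n` has finite length `p(n)` for all large `n`, and `e` is
`d!` times the leading coefficient of `p`. For a Noetherian local ring such `p` and `e` exist and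
are unique. -/
def HasMultiplicity (A : Type*) [CommRing A] [IsLocalRing A] (e : ℚ) : Prop :=
  ∃ (d : ℕ) (p : Polynomial ℚ),
    ringKrullDim A = d ∧ p.natDegree = d ∧
    (∀ᶠ n : ℕ in Filter.atTop, ∃ l : ℕ,
      Module.length A (A ⧸ IsLocalRing.maximalIdeal A ^ n) = l ∧ (l : ℚ) = p.eval (n : ℚ)) ∧
    e = (d ! : ℚ) * p.leadingCoeff

/-!
If multiplication by `y` is injective, then `ℓ(I / yI)` is the same for all ideals `I` of finite
colength, hence equal to `e = ℓ(R / yR)`. If `M ^ n` is two-generated with `n ≥ 2`, then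
`M ^ n / M ^ (n + 1)` has length at most `2`, and its elements are sums of products of elements of
`M`; this forces `M ^ n = y M ^ (n - 1)` for some `y ∈ M`, a nonzerodivisor because `M` is regular.
Then `e = ℓ(M ^ n / M ^ (n + 1)) ≤ 2`. As every regular ideal `I` contains a power of `y`, we get
`ℓ(I / MI) ≤ ℓ(I / yI) = e ≤ 2`, and Nakayama's lemma gives two generators.

The completion `A` is Noetherian as soon as `R / mR` is, and it has the same quotients
`A / M ^ n A = R / M ^ n` as `R`. Since `ℓ(R / M ^ n)` grows with slope `e` for large `n`, the
multiplicity of `A` is `e`. Conversely, if the Hilbert polynomial of `A` has slope at most `2`, then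
`ℓ(M ^ n / M ^ (n + 1)) ≤ 2` for large `n`, so `M ^ n` is two-generated.
-/

open IsLocalRing Pointwise

section RelativeLength

variable {R E : Type*} [CommRing R] [AddCommGroup E] [Module R E] {I J K N : Submodule R E} {y : R}

/-- The length of `J / (I ∩ J)`; for `I ≤ J` this is the relative length `ℓ(J / I)`, which can be
manipulated without changing the ambient module. -/
noncomputable def relLength (I J : Submodule R E) : ℕ∞ :=
  Module.length R (J ⧸ I.submoduleOf J)

theorem relLength_top (I : Submodule R E) : relLength I ⊤ = Module.length R (E ⧸ I) :=
  (Submodule.Quotient.equiv (I.submoduleOf ⊤) I Submodule.topEquiv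
    (by ext x; simp [Submodule.submoduleOf])).length_eq

theorem relLength_eq_zero : relLength I J = 0 ↔ J ≤ I := by
  rw [relLength, Module.length_eq_zero_iff, Submodule.Quotient.subsingleton_iff,
    Submodule.submoduleOf_eq_top]

theorem relLength_eq_add (hIJ : I ≤ J) (hJK : J ≤ K) :
    relLength I K = relLength I J + relLength J K := by
  let f : (J ⧸ I.submoduleOf J) →ₗ[R] (K ⧸ I.submoduleOf K) :=
    Submodule.mapQ _ _ (Submodule.inclusion hJK) fun _ hx => hx
  let g : (K ⧸ I.submoduleOf K) →ₗ[R] (K ⧸ J.submoduleOf K) :=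
    Submodule.factor (Submodule.comap_mono hIJ)
  have hf : Function.Injective f := by
    rw [← LinearMap.ker_eq_bot]
    refine (Submodule.ker_mapQ _ _ _ _).trans ?_
    exact Submodule.mkQ_map_self (I.submoduleOf J)
  have hfg : Function.Exact f g := by
    rw [LinearMap.exact_iff]
    refine (Submodule.ker_mapQ _ _ _ _).trans (Eq.trans ?_ (Submodule.range_mapQ _ _ _ _).symm)
    rw [Submodule.range_inclusion]
    rfl
  exact Module.length_eq_add_of_exact f g hf (Submodule.factor_surjective _) hfg

theorem relLength_anti_left (hIJ : I ≤ J) (hJK : J ≤ K) : relLength J K ≤ relLength I K := by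
  rw [relLength_eq_add hIJ hJK]
  exact le_add_self

theorem relLength_mono_right (hIJ : I ≤ J) (hJK : J ≤ K) : relLength I J ≤ relLength I K := by
  rw [relLength_eq_add hIJ hJK]
  exact le_self_add

theorem one_le_relLength (h : I < J) : 1 ≤ relLength I J := by
  rw [Order.one_le_iff_ne_zero, Ne, relLength_eq_zero]
  exact h.not_ge

theorem relLength_smul (hy : IsSMulRegular E y) : relLength (y • I) (y • J) = relLength I J := by
  let e : J ≃ₗ[R] (y • J : Submodule R E) :=
    Submodule.equivMapOfInjective (DistribSMul.toLinearMap R E y) hy J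
  refine (Submodule.Quotient.equiv _ _ e ?_).length_eq.symm
  have hcomap : ((y • I).submoduleOf (y • J)).comap (e : J →ₗ[R] (y • J : Submodule R E)) =
      I.submoduleOf J :=
    congrArg (Submodule.comap J.subtype)
      (Submodule.comap_map_eq_of_injective (f := DistribSMul.toLinearMap R E y) hy I)
  rw [← hcomap, Submodule.map_comap_eq_of_surjective e.surjective]

theorem relLength_smul_eq (hy : IsSMulRegular E y) (hNK : N ≤ K) (h : relLength N K ≠ ⊤) :
    relLength (y • N) N = relLength (y • K) K := by
  refine WithTop.add_right_cancel h ?_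
  calc relLength (y • N) N + relLength N K
      = relLength (y • N) K :=
        (relLength_eq_add (Submodule.smul_le_self_of_tower y N) hNK).symm
    _ = relLength (y • N) (y • K) + relLength (y • K) K :=
        relLength_eq_add (smul_mono_right y hNK) (Submodule.smul_le_self_of_tower y K)
    _ = relLength (y • K) K + relLength N K := by rw [relLength_smul hy, add_comm]

theorem relLength_pow_smul_ne_top (hy : IsSMulRegular E y) (h : relLength (y • N) N ≠ ⊤) (n : ℕ) :
    relLength (y ^ n • N) N ≠ ⊤ := by
  induction n with
  | zero =>
    rw [pow_zero, one_smul, relLength_eq_zero.2 le_rfl]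
    exact ENat.zero_ne_top
  | succ n ih =>
    rw [pow_succ, mul_smul, relLength_eq_add
      (smul_mono_right (y ^ n) (Submodule.smul_le_self_of_tower y N))
      (Submodule.smul_le_self_of_tower (y ^ n) N), relLength_smul (hy.pow n)]
    exact WithTop.add_ne_top.2 ⟨h, ih⟩

theorem fg_of_relLength_ne_top (hI : I.FG) (hIJ : I ≤ J) (h : relLength I J ≠ ⊤) : J.FG := by
  rw [relLength, Module.length_ne_top_iff, isFiniteLength_iff_isNoetherian_isArtinian] at h
  have := h.1
  have : Module.Finite R I := Module.Finite.iff_fg.2 hI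
  have : Module.Finite R (I.submoduleOf J) :=
    Module.Finite.equiv (Submodule.submoduleOfEquivOfLe hIJ).symm
  exact Module.Finite.iff_fg.1 (Module.Finite.of_submodule_quotient (I.submoduleOf J))

theorem eq_of_relLength_le_two {L L' : Submodule R E} (h : relLength K N ≤ 2) (hKL : K < L)
    (hLL' : L ≤ L') (hLN : L' < N) : L = L' := by
  by_contra hne
  have hlen : (1 : ℕ∞) + (1 + 1) ≤ 2 := by
    calc (1 : ℕ∞) + (1 + 1) ≤ relLength K L + (relLength L L' + relLength L' N) := by
          gcongr
          exacts [one_le_relLength hKL, one_le_relLength (hLL'.lt_of_ne hne), one_le_relLength hLN]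
      _ = relLength K N := by
          rw [relLength_eq_add hKL.le (hLL'.trans hLN.le), relLength_eq_add hLL' hLN.le]
      _ ≤ 2 := h
  exact absurd hlen (by decide)

theorem eq_of_mem_of_notMem {L L' : Submodule R E} (h : relLength K N ≤ 2) (hKL : K ≤ L)
    (hKL' : K ≤ L') (hLN : L < N) (hLN' : L' < N) {a : E} (ha : a ∈ L) (ha' : a ∈ L')
    (haK : a ∉ K) : L = L' := by
  have hlt : K < L ⊓ L' := lt_of_le_not_ge (le_inf hKL hKL') fun hle => haK (hle ⟨ha, ha'⟩)
  exact (eq_of_relLength_le_two h hlt inf_le_left hLN).symm.trans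
    (eq_of_relLength_le_two h hlt inf_le_right hLN')

end RelativeLength

section TwoGenerated

variable {R : Type*} [CommRing R]

theorem twoGenerated_iff_spanFinrank_le {I : Ideal R} :
    TwoGenerated I ↔ I.FG ∧ I.spanFinrank ≤ 2 := by
  constructor
  · rintro ⟨x, y, rfl⟩
    exact ⟨Submodule.fg_span (Set.toFinite _),
      (Submodule.spanFinrank_span_le_ncard_of_finite (Set.toFinite _)).trans
        (by simpa using Set.ncard_insert_le x {y})⟩
  · rintro ⟨hfg, hle⟩
    obtain ⟨s, hs, rfl⟩ := Submodule.FG.exists_span_finset_card_eq_spanFinrank hfg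
    rw [← hs] at hle
    interval_cases hcard : s.card
    · exact ⟨0, 0, by simp [Finset.card_eq_zero.1 hcard]⟩
    · obtain ⟨x, rfl⟩ := Finset.card_eq_one.1 hcard
      exact ⟨x, x, by simp⟩
    · classical
      obtain ⟨x, y, -, rfl⟩ := Finset.card_eq_two.1 hcard
      exact ⟨x, y, by simp⟩

theorem relLength_maximalIdeal_smul_eq_spanFinrank [IsLocalRing R] {E : Type*} [AddCommGroup E]
    [Module R E] {N : Submodule R E} (hN : N.FG) :
    relLength (maximalIdeal R • N) N = N.spanFinrank := by
  have hsub : (maximalIdeal R • N).submoduleOf N = maximalIdeal R • (⊤ : Submodule R N) := by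
    refine (congrArg _ ?_).trans (Submodule.comap_map_eq_of_injective N.subtype_injective _)
    rw [Submodule.map_smul'', Submodule.map_subtype_top]
  let : Field (R ⧸ maximalIdeal R) := Ideal.Quotient.field _
  have : Module.Finite R N := Module.Finite.iff_fg.2 hN
  have : Module.Finite (R ⧸ maximalIdeal R) (N ⧸ maximalIdeal R • (⊤ : Submodule R N)) :=
    Module.Finite.of_restrictScalars_finite R _ _
  rw [relLength, hsub, spanFinrank_eq_finrank_quotient N hN,
    Module.length_eq_of_surjective (R := R ⧸ maximalIdeal R) Ideal.Quotient.mk_surjective,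
    Module.length_eq_finrank]

theorem twoGenerated_iff_relLength_le [IsLocalRing R] {I : Ideal R} :
    TwoGenerated I ↔ I.FG ∧ relLength (maximalIdeal R • I) I ≤ 2 := by
  rw [twoGenerated_iff_spanFinrank_le]
  refine and_congr_right fun hI => ?_
  rw [relLength_maximalIdeal_smul_eq_spanFinrank hI]
  norm_cast

end TwoGenerated

section Reduction

variable {R : Type*} [CommRing R] {I : Ideal R} {y : R}

theorem exists_mul_mul_notMem {Q : Ideal R} {k : ℕ} (h : ¬ I ^ (k + 2) ≤ Q) :
    ∃ x ∈ I, ∃ z ∈ I, ∃ u ∈ I ^ k, x * (z * u) ∉ Q := by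
  contrapose! h
  rw [pow_succ', pow_succ', Ideal.mul_le]
  intro x hx s hs
  refine Submodule.mul_induction_on hs (fun z hz u hu => h x hx z hz u hu) fun s t hs ht => ?_
  rw [mul_add]
  exact add_mem hs ht

theorem smul_pow_le_pow_succ (hy : y ∈ I) (n : ℕ) : y • I ^ n ≤ I ^ (n + 1) := by
  rw [← Submodule.ideal_span_singleton_smul, pow_succ', smul_eq_mul]
  exact Ideal.mul_mono_left ((Ideal.span_singleton_le_iff_mem I).2 hy)

theorem mul_mul_mem_smul_pow_succ {x z u : R} {k : ℕ} (hz : z ∈ I) (hu : u ∈ I ^ k) :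
    x * (z * u) ∈ x • I ^ (k + 1) := by
  refine Submodule.smul_mem_pointwise_smul _ x _ ?_
  rw [pow_succ']
  exact Ideal.mul_mem_mul hz hu

/-- Modulo `W` the submodules `x • I ^ (k + 1)` are at most lines in a plane. If none is everything,
take a product `x₁ x₂ u` outside `W` and a product `z₁ z₂ v` off the line of `x₁`. The line of `x₁`
is also that of `x₂`, the line of `z₁` is also that of `z₂`, so the mixed products `x₁ z₂ v` and
`z₁ x₂ u` lie on both lines and vanish. Hence the line of `x₁ + z₁` contains both products. -/
theorem exists_pow_le_smul_sup {W : Ideal R} {k : ℕ} (hW : W ≤ I ^ (k + 2))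
    (hlen : relLength W (I ^ (k + 2)) ≤ 2) : ∃ y ∈ I, I ^ (k + 2) ≤ y • I ^ (k + 1) ⊔ W := by
  by_contra! hcon
  let P (x : R) : Ideal R := x • I ^ (k + 1) ⊔ W
  have hWP (x : R) : W ≤ P x := le_sup_right
  have hPlt {x : R} (hx : x ∈ I) : P x < I ^ (k + 2) :=
    lt_of_le_not_ge (sup_le (smul_pow_le_pow_succ hx _) hW) (hcon x hx)
  have hmem {x z u : R} (hz : z ∈ I) (hu : u ∈ I ^ k) : x * (z * u) ∈ P x :=
    Submodule.mem_sup_left (mul_mul_mem_smul_pow_succ hz hu)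
  have hmem' {x z u : R} (hx : x ∈ I) (hu : u ∈ I ^ k) : x * (z * u) ∈ P z := by
    rw [mul_left_comm]
    exact hmem hx hu
  have heq {x z a : R} (hx : x ∈ I) (hz : z ∈ I) (hax : a ∈ P x) (haz : a ∈ P z) (ha : a ∉ W) :
      P x = P z :=
    eq_of_mem_of_notMem hlen (hWP x) (hWP z) (hPlt hx) (hPlt hz) hax haz ha
  obtain ⟨x₁, hx₁, x₂, hx₂, u, hu, ha⟩ :=
    exists_mul_mul_notMem fun h => hcon 0 (zero_mem I) (h.trans (hWP 0))
  obtain ⟨z₁, hz₁, z₂, hz₂, v, hv, hb⟩ := exists_mul_mul_notMem (Q := P x₁) (hcon x₁ hx₁)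
  have hx : P x₁ = P x₂ := heq hx₁ hx₂ (hmem hx₂ hu) (hmem' hx₁ hu) ha
  have hz : P z₁ = P z₂ :=
    heq hz₁ hz₂ (hmem hz₂ hv) (hmem' hz₁ hv) fun h => hb (hWP x₁ h)
  have hne : P x₁ ≠ P z₁ := fun h => hb (h ▸ hmem hz₂ hv)
  have hxz : x₁ * (z₂ * v) ∈ W := by
    by_contra h
    exact hne (heq hx₁ hz₁ (hmem hz₂ hv) (hz ▸ hmem' hx₁ hv) h)
  have hzx : z₁ * (x₂ * u) ∈ W := by
    by_contra h
    exact hne (heq hx₁ hz₁ (hx ▸ hmem' hz₁ hu) (hmem hx₂ hu) h)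
  have ha' : x₁ * (x₂ * u) ∈ P (x₁ + z₁) := by
    have h := sub_mem (hmem (x := x₁ + z₁) hx₂ hu) (hWP _ hzx)
    rwa [add_mul, add_sub_cancel_right] at h
  have hb' : z₁ * (z₂ * v) ∈ P (x₁ + z₁) := by
    have h := sub_mem (hmem (x := x₁ + z₁) hz₂ hv) (hWP _ hxz)
    rwa [add_mul, add_sub_cancel_left] at h
  exact hb (heq (add_mem hx₁ hz₁) hx₁ ha' (hmem hx₂ hu) ha ▸ hb')

theorem pow_succ_eq_smul_of_le {n j : ℕ} (h : I ^ (n + 1) = y • I ^ n) (hj : n ≤ j) :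
    I ^ (j + 1) = y • I ^ j := by
  obtain ⟨i, rfl⟩ := Nat.exists_eq_add_of_le hj
  rw [add_right_comm, pow_add, h, pow_add, ← Submodule.ideal_span_singleton_smul,
    ← Submodule.ideal_span_singleton_smul, smul_eq_mul, smul_eq_mul, mul_assoc]

end Reduction

section Parameter

variable {R : Type*} [CommRing R] {y : R} {I : Ideal R}

theorem isSMulRegular_of_mem_nonZeroDivisors (hy : y ∈ nonZeroDivisors R) : IsSMulRegular R y :=
  (isRegular_iff_mem_nonZeroDivisors.2 hy).left

theorem smul_top_eq_span (y : R) : y • (⊤ : Ideal R) = Ideal.span {y} := by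
  rw [← Submodule.ideal_span_singleton_smul, smul_eq_mul, Ideal.mul_top]

theorem relLength_smul_top (y : R) :
    relLength (y • (⊤ : Ideal R)) ⊤ = Module.length R (R ⧸ Ideal.span {y}) := by
  rw [smul_top_eq_span, relLength_top]

theorem relLength_smul_eq_length_quotient (hy : y ∈ nonZeroDivisors R)
    (hI : Module.length R (R ⧸ I) ≠ ⊤) :
    relLength (y • I) I = Module.length R (R ⧸ Ideal.span {y}) := by
  rw [relLength_smul_eq (isSMulRegular_of_mem_nonZeroDivisors hy) le_top (by rwa [relLength_top]),
    relLength_smul_top]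

theorem length_quotient_span_pow_ne_top (hy : y ∈ nonZeroDivisors R)
    (hlen : Module.length R (R ⧸ Ideal.span {y}) ≠ ⊤) (n : ℕ) :
    Module.length R (R ⧸ Ideal.span {y ^ n}) ≠ ⊤ := by
  rw [← relLength_smul_top] at hlen ⊢
  exact relLength_pow_smul_ne_top (isSMulRegular_of_mem_nonZeroDivisors hy) hlen n

theorem length_quotient_ne_top_of_mem_radical (hy : y ∈ nonZeroDivisors R)
    (hlen : Module.length R (R ⧸ Ideal.span {y}) ≠ ⊤) (hyI : y ∈ I.radical) :
    Module.length R (R ⧸ I) ≠ ⊤ := by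
  obtain ⟨n, hn⟩ := hyI
  have hfin := length_quotient_span_pow_ne_top hy hlen n
  rw [← relLength_top] at hfin ⊢
  exact ne_top_of_le_ne_top hfin
    (relLength_anti_left ((Ideal.span_singleton_le_iff_mem I).2 hn) le_top)

theorem fg_of_mem_radical (hy : y ∈ nonZeroDivisors R)
    (hlen : Module.length R (R ⧸ Ideal.span {y}) ≠ ⊤) (hyI : y ∈ I.radical) : I.FG := by
  obtain ⟨n, hn⟩ := hyI
  have hfin := length_quotient_span_pow_ne_top hy hlen n
  rw [← relLength_top] at hfin
  have hle : Ideal.span {y ^ n} ≤ I := (Ideal.span_singleton_le_iff_mem I).2 hn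
  exact fg_of_relLength_ne_top (Submodule.fg_span_singleton _) hle
    (ne_top_of_le_ne_top hfin (relLength_mono_right hle le_top))

theorem mem_nonZeroDivisors_of_pow_le_smul {J : Ideal R} {n : ℕ} (hI : RegularIdeal I)
    (h : I ^ n ≤ y • J) : y ∈ nonZeroDivisors R := by
  obtain ⟨m, hmI, hm⟩ := hI
  obtain ⟨w, -, hw : y * w = m ^ n⟩ :=
    (Submodule.mem_smul_pointwise_iff_exists _ _ _).1 (h (Ideal.pow_mem_pow hmI n))
  exact (mul_mem_nonZeroDivisors.1 (hw ▸ pow_mem hm n)).1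

theorem length_quotient_pow_add {n : ℕ} (hyI : y ∈ I) (hy : y ∈ nonZeroDivisors R)
    (hlen : Module.length R (R ⧸ Ideal.span {y}) ≠ ⊤) (hpow : I ^ (n + 1) = y • I ^ n) (i : ℕ) :
    Module.length R (R ⧸ I ^ (n + i)) =
      Module.length R (R ⧸ I ^ n) + i * Module.length R (R ⧸ Ideal.span {y}) := by
  induction i with
  | zero => rw [add_zero, Nat.cast_zero, zero_mul, add_zero]
  | succ i ih =>
    have hfin : Module.length R (R ⧸ I ^ (n + i)) ≠ ⊤ :=
      length_quotient_ne_top_of_mem_radical hy hlen ⟨n + i, Ideal.pow_mem_pow hyI _⟩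
    have hstep : relLength (I ^ (n + i + 1)) (I ^ (n + i)) =
        Module.length R (R ⧸ Ideal.span {y}) := by
      rw [pow_succ_eq_smul_of_le hpow (Nat.le_add_right n i),
        relLength_smul_eq_length_quotient hy hfin]
    rw [← add_assoc, ← relLength_top,
      relLength_eq_add (Ideal.pow_le_pow_right (Nat.le_succ _)) le_top, hstep, relLength_top, ih]
    push_cast
    ring

variable [IsLocalRing R] {k : ℕ}

theorem exists_maximalIdeal_pow_eq_smul (h : TwoGenerated (maximalIdeal R ^ (k + 2))) :
    ∃ y ∈ maximalIdeal R, maximalIdeal R ^ (k + 2) = y • maximalIdeal R ^ (k + 1) := by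
  obtain ⟨hfg, hlen⟩ := twoGenerated_iff_relLength_le.1 h
  obtain ⟨y, hy, hle⟩ := exists_pow_le_smul_sup Submodule.smul_le_right hlen
  exact ⟨y, hy, le_antisymm
    (Submodule.le_of_le_smul_of_le_jacobson_bot hfg (maximalIdeal_le_jacobson ⊥) hle)
    (smul_pow_le_pow_succ hy _)⟩

theorem length_quotient_span_le_two (h : TwoGenerated (maximalIdeal R ^ (k + 2)))
    (hyM : y ∈ maximalIdeal R) (hy : y ∈ nonZeroDivisors R)
    (hpow : maximalIdeal R ^ (k + 2) = y • maximalIdeal R ^ (k + 1)) :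
    Module.length R (R ⧸ Ideal.span {y}) ≤ 2 := by
  set J := maximalIdeal R ^ (k + 2)
  have hys := isSMulRegular_of_mem_nonZeroDivisors hy
  have hJlen : relLength (y • J) J ≤ 2 := by
    rw [← pow_succ_eq_smul_of_le hpow (Nat.le_succ _), pow_succ']
    exact (twoGenerated_iff_relLength_le.1 h).2
  have hle : y ^ (k + 2) • (⊤ : Ideal R) ≤ J := by
    rw [smul_top_eq_span, Ideal.span_singleton_le_iff_mem]
    exact Ideal.pow_mem_pow hyM _
  -- Multiplication by `y ^ (k + 2)` embeds `R / J` into `J / y ^ (k + 2) J`.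
  have hJtop : relLength J ⊤ ≠ ⊤ := by
    rw [← relLength_smul (hys.pow (k + 2))]
    refine ne_top_of_le_ne_top ?_ (relLength_mono_right (smul_mono_right _ le_top) hle)
    exact relLength_pow_smul_ne_top hys (ne_top_of_le_ne_top (by decide) hJlen) (k + 2)
  rwa [← relLength_smul_eq_length_quotient hy (by rwa [← relLength_top])]

theorem exists_parameter_of_twoGenerated_pow (hM : RegularIdeal (maximalIdeal R))
    (h : TwoGenerated (maximalIdeal R ^ (k + 2))) :
    ∃ y ∈ maximalIdeal R, y ∈ nonZeroDivisors R ∧ Module.length R (R ⧸ Ideal.span {y}) ≤ 2 ∧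
      maximalIdeal R ^ (k + 2) = y • maximalIdeal R ^ (k + 1) := by
  obtain ⟨y, hyM, hpow⟩ := exists_maximalIdeal_pow_eq_smul h
  have hy := mem_nonZeroDivisors_of_pow_le_smul hM hpow.le
  exact ⟨y, hyM, hy, length_quotient_span_le_two h hyM hy hpow, hpow⟩

theorem twoGenerated_of_mem_radical (hyM : y ∈ maximalIdeal R) (hy : y ∈ nonZeroDivisors R)
    (hlen : Module.length R (R ⧸ Ideal.span {y}) ≤ 2) (hyI : y ∈ I.radical) : TwoGenerated I := by
  have hlen' := ne_top_of_le_ne_top (by decide) hlen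
  have hle : y • I ≤ maximalIdeal R • I := by
    rw [← Submodule.ideal_span_singleton_smul]
    exact Submodule.smul_mono_left ((Ideal.span_singleton_le_iff_mem _).2 hyM)
  refine twoGenerated_iff_relLength_le.2 ⟨fg_of_mem_radical hy hlen' hyI, ?_⟩
  calc relLength (maximalIdeal R • I) I ≤ relLength (y • I) I :=
        relLength_anti_left hle Submodule.smul_le_right
    _ = Module.length R (R ⧸ Ideal.span {y}) := relLength_smul_eq_length_quotient hy
        (length_quotient_ne_top_of_mem_radical hy hlen' hyI)
    _ ≤ 2 := hlen

end Parameter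

section RegularPrimes

variable {R : Type*} [CommRing R]

theorem RegularIdeal.mono {I J : Ideal R} (hI : RegularIdeal I) (hIJ : I ≤ J) : RegularIdeal J :=
  hI.imp fun _ hx => ⟨hIJ hx.1, hx.2⟩

theorem isMaximal_of_regularIdeal [Ring.KrullDimLE 1 R] {P : Ideal R} [P.IsPrime]
    (hP : RegularIdeal P) : P.IsMaximal := by
  obtain ⟨x, hxP, hx⟩ := hP
  exact (Ring.krullDimLE_one_iff.1 ‹_› P ‹_›).resolve_left fun hmin =>
    notMem_nonZeroDivisors_of_mem_mem_minimalPrimes hxP hmin hx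

variable (hprime : ∀ P : Ideal R, P.IsPrime → RegularIdeal P → P.IsMaximal)
include hprime

theorem ringKrullDim_quotient_eq_zero {I : Ideal R} (hI : RegularIdeal I) (hne : I ≠ ⊤) :
    ringKrullDim (R ⧸ I) = 0 := by
  have : Nontrivial (R ⧸ I) := Ideal.Quotient.nontrivial_iff.2 hne
  refine ringKrullDimZero_iff_ringKrullDim_eq_zero.1 ?_
  rw [Ideal.krullDimLE_zero_quotient_iff_forall_minimalPrimes_isMaximal]
  exact fun P hP => hprime P hP.1.1 (hI.mono hP.1.2)

variable [IsLocalRing R]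

theorem maximalIdeal_le_radical {I : Ideal R} (hI : RegularIdeal I) :
    maximalIdeal R ≤ I.radical := by
  rw [Ideal.radical_eq_sInf]
  exact le_sInf fun P ⟨hIP, hP⟩ => (eq_maximalIdeal (hprime P hP (hI.mono hIP))).ge

theorem twoGenerated_of_twoGenerated_pow (hM : RegularIdeal (maximalIdeal R)) {k : ℕ}
    (h : TwoGenerated (maximalIdeal R ^ (k + 2))) {I : Ideal R} (hI : RegularIdeal I) :
    TwoGenerated I := by
  obtain ⟨y, hyM, hy, hlen, -⟩ := exists_parameter_of_twoGenerated_pow hM h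
  exact twoGenerated_of_mem_radical hyM hy hlen (maximalIdeal_le_radical hprime hI hyM)

end RegularPrimes

section AdicallyComplete

variable {A : Type*} [CommRing A] (I : Ideal A)

theorem isPrecomplete_pi {ι : Type*} [Finite ι] [IsPrecomplete I A] : IsPrecomplete I (ι → A) := by
  classical
  have := Fintype.ofFinite ι
  rw [← AdicCompletion.of_surjective_iff]
  intro x
  choose c hc using fun i => AdicCompletion.of_surjective I A
    (AdicCompletion.piEquivOfFintype I (fun _ : ι => A) x i)
  refine ⟨c, (AdicCompletion.piEquivOfFintype I fun _ : ι => A).injective (funext fun i => ?_)⟩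
  rw [← hc i, AdicCompletion.piEquivOfFintype_apply]
  rfl

theorem isHausdorff_submodule {E : Type*} [AddCommGroup E] [Module A E] [IsHausdorff I E]
    (N : Submodule A E) : IsHausdorff I N := by
  refine ⟨fun x hx => Subtype.ext (IsHausdorff.haus ‹_› (x : E) fun n => ?_)⟩
  have hxn := hx n
  rw [SModEq.zero] at hxn ⊢
  have hmap : I ^ n • (⊤ : Submodule A N) ≤ (I ^ n • (⊤ : Submodule A E)).comap N.subtype := by
    rw [← Submodule.map_le_iff_le_comap, Submodule.map_smul'']
    exact Submodule.smul_mono le_rfl le_top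
  exact hmap hxn

theorem finite_of_finite_quotient_smul_top {N : Type*} [AddCommGroup N] [Module A N]
    [IsPrecomplete I A] [IsHausdorff I N] [Module.Finite A (N ⧸ (I • ⊤ : Submodule A N))] :
    Module.Finite A N := by
  obtain ⟨n, f, hf⟩ := Module.Finite.exists_fin' A (N ⧸ (I • ⊤ : Submodule A N))
  obtain ⟨g, hg⟩ := Module.projective_lifting_property (Submodule.mkQ (I • ⊤ : Submodule A N)) f
    (Submodule.mkQ_surjective _)
  have := isPrecomplete_pi I (ι := Fin n)
  refine Module.Finite.of_surjective g (surjective_of_mkQ_comp_surjective (I := I) ?_)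
  rwa [hg]

theorem ker_mkQ_comp_subtype_of_isPrime {P : Ideal A} [P.IsPrime] {t : A} (ht : t ∉ P) :
    LinearMap.ker ((Ideal.span {t}).mkQ ∘ₗ P.subtype) = Ideal.span {t} • (⊤ : Submodule A P) := by
  ext ⟨x, hx⟩
  rw [Submodule.ideal_span_singleton_smul, Submodule.mem_smul_pointwise_iff_exists]
  simp only [LinearMap.mem_ker, LinearMap.comp_apply, Submodule.subtype_apply,
    Submodule.mkQ_apply, Submodule.Quotient.mk_eq_zero, Ideal.mem_span_singleton]
  constructor
  · rintro ⟨a, rfl⟩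
    exact ⟨⟨a, (Ideal.IsPrime.mem_or_mem ‹_› hx).resolve_left ht⟩, trivial, rfl⟩
  · rintro ⟨a, -, ha⟩
    exact ⟨a, congrArg Subtype.val ha.symm⟩

theorem isNoetherian_quotient_of_isNoetherianRing [IsNoetherianRing (A ⧸ I)] :
    IsNoetherian A (A ⧸ I) := by
  let f : (A ⧸ I) →ₛₗ[Ideal.Quotient.mk I] (A ⧸ I) :=
    { toFun := id, map_add' := fun _ _ => rfl, map_smul' := fun _ _ => rfl }
  exact (LinearMap.isNoetherian_iff_of_bijective f Function.bijective_id).2 ‹_›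

theorem fg_of_mem_of_isNoetherianRing_quotient {K : Ideal A} {t : A} (ht : t ∈ K)
    [IsNoetherianRing (A ⧸ Ideal.span {t})] : K.FG := by
  refine Ideal.fg_of_fg_map_of_fg_inf_ker_of_surjective (f := Ideal.Quotient.mk (Ideal.span {t}))
    (IsNoetherian.noetherian _) ?_ Ideal.Quotient.mk_surjective
  rw [Ideal.mk_ker, inf_eq_right.2 ((Ideal.span_singleton_le_iff_mem _).2 ht)]
  exact Submodule.fg_span_singleton t

theorem isNoetherianRing_of_isAdicComplete_span_singleton (t : A)
    [IsAdicComplete (Ideal.span {t}) A] [IsNoetherianRing (A ⧸ Ideal.span {t})] :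
    IsNoetherianRing A := by
  refine IsNoetherianRing.of_prime fun P hP => ?_
  by_cases ht : t ∈ P
  · exact fg_of_mem_of_isNoetherianRing_quotient ht
  · have := isNoetherian_quotient_of_isNoetherianRing (Ideal.span {t})
    have : Module.Finite A (P ⧸ Ideal.span {t} • (⊤ : Submodule A P)) := by
      rw [← ker_mkQ_comp_subtype_of_isPrime ht]
      exact Module.Finite.equiv (LinearMap.quotKerEquivRange _).symm
    have := isHausdorff_submodule (Ideal.span {t}) P
    exact Module.Finite.iff_fg.1 (finite_of_finite_quotient_smul_top (Ideal.span {t}))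

end AdicallyComplete

section Completion

variable {R : Type*} [CommRing R] {I : Ideal R}

theorem ker_evalₐ_eq_map (hI : I.FG) (n : ℕ) :
    RingHom.ker (AdicCompletion.evalₐ I n) =
      (I ^ n).map (algebraMap R (AdicCompletion I R)) := by
  ext x
  have hmem : x ∈ (I ^ n).map (algebraMap R (AdicCompletion I R)) ↔
      AdicCompletion.eval I R n x = 0 := by
    rw [← LinearMap.mem_ker, ← AdicCompletion.pow_smul_top_eq_ker_eval hI, Ideal.smul_top_eq_map]
    rfl
  rw [hmem, RingHom.mem_ker]
  constructor <;> intro hx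
  · rw [← AdicCompletion.factor_evalₐ_eq_eval I x (by simp), hx, map_zero]
  · rw [← AdicCompletion.factor_eval_eq_evalₐ I x (by simp), hx, map_zero]

theorem exists_sub_algebraMap_mem_map_pow (hI : I.FG) (n : ℕ) (x : AdicCompletion I R) :
    ∃ r : R, x - algebraMap R _ r ∈ (I ^ n).map (algebraMap R (AdicCompletion I R)) := by
  obtain ⟨r, hr⟩ := Ideal.Quotient.mk_surjective (AdicCompletion.evalₐ I n x)
  refine ⟨r, ?_⟩
  rw [← ker_evalₐ_eq_map hI, RingHom.mem_ker, map_sub, ← hr, AlgHom.commutes, sub_eq_zero]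
  rfl

theorem algebraMap_mem_map_iff {K : Ideal R} {n : ℕ} (hK : I ^ n ≤ K) {r : R} :
    algebraMap R (AdicCompletion I R) r ∈ K.map (algebraMap R (AdicCompletion I R)) ↔ r ∈ K := by
  refine ⟨fun hr => ?_, Ideal.mem_map_of_mem _⟩
  have hcomp : (AdicCompletion.evalₐ I n).toRingHom.comp (algebraMap R (AdicCompletion I R)) =
      Ideal.Quotient.mk (I ^ n) := (AdicCompletion.evalₐ I n).comp_algebraMap
  have hr' := Ideal.mem_map_of_mem (AdicCompletion.evalₐ I n).toRingHom hr
  rw [Ideal.map_map, hcomp, ← RingHom.comp_apply, hcomp] at hr'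
  exact (Ideal.mem_quotient_iff_mem hK).1 hr'

/-- The isomorphism `R / K ≃ A / K A` for an open ideal `K` of `R`, with `A` the `I`-adic completion
of `R`. -/
noncomputable def quotientMapAlgEquiv (hI : I.FG) {K : Ideal R} {n : ℕ} (hK : I ^ n ≤ K) :
    (R ⧸ K) ≃ₐ[R] (AdicCompletion I R ⧸ K.map (algebraMap R (AdicCompletion I R))) :=
  AlgEquiv.ofBijective (Ideal.quotientMapₐ _ (Algebra.ofId R _) Ideal.le_comap_map)
    ⟨Ideal.quotientMap_injective' (H := Ideal.le_comap_map) fun _ hr =>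
      (algebraMap_mem_map_iff hK).1 hr, fun x => by
      obtain ⟨x, rfl⟩ := Ideal.Quotient.mk_surjective x
      obtain ⟨r, hr⟩ := exists_sub_algebraMap_mem_map_pow hI n x
      exact ⟨Ideal.Quotient.mk K r, (Ideal.Quotient.eq.2 (Ideal.map_mono hK hr)).symm⟩⟩

theorem length_quotient_map (hI : I.FG) {K : Ideal R} {n : ℕ} (hK : I ^ n ≤ K) :
    Module.length (AdicCompletion I R)
      (AdicCompletion I R ⧸ K.map (algebraMap R (AdicCompletion I R))) =
    Module.length R (R ⧸ K) := by
  let e := quotientMapAlgEquiv hI hK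
  have hsurj : Function.Surjective
      (algebraMap R (AdicCompletion I R ⧸ K.map (algebraMap R (AdicCompletion I R)))) := by
    rw [← e.toAlgHom.comp_algebraMap]
    exact e.surjective.comp Ideal.Quotient.mk_surjective
  rw [e.toLinearEquiv.length_eq,
    Module.length_eq_of_surjective hsurj]
  exact Module.length_eq_of_surjective Ideal.Quotient.mk_surjective

section IsLocalRing

variable [IsLocalRing R] (hI : I.FG) (hIM : I ≤ maximalIdeal R)
include hI hIM

theorem isLocalRing_adicCompletion : IsLocalRing (AdicCompletion I R) := by
  let J := I.map (algebraMap R (AdicCompletion I R))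
  have := AdicCompletion.isAdicComplete_self I hI
  have : IsLocalHom (Ideal.Quotient.mk J) :=
    isLocalHom_of_le_jacobson_bot J (IsAdicComplete.le_jacobson_bot J)
  have : Nontrivial (R ⧸ I) :=
    Ideal.Quotient.nontrivial_iff.2 (ne_top_of_le_ne_top Ideal.IsPrime.ne_top' hIM)
  have : IsLocalRing (R ⧸ I) := IsLocalRing.of_surjective' _ Ideal.Quotient.mk_surjective
  have : IsLocalRing (AdicCompletion I R ⧸ J) :=
    (quotientMapAlgEquiv hI (pow_one I).le).toRingEquiv.isLocalRing
  exact RingHom.domain_isLocalRing (Ideal.Quotient.mk J)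

theorem maximalIdeal_adicCompletion [IsLocalRing (AdicCompletion I R)] :
    maximalIdeal (AdicCompletion I R) =
      (maximalIdeal R).map (algebraMap R (AdicCompletion I R)) :=
  (eq_maximalIdeal (AdicCompletion.isMaximal_map_of_le I (maximalIdeal R) hIM hI)).symm

theorem length_quotient_maximalIdeal_pow_adicCompletion [IsLocalRing (AdicCompletion I R)]
    (n : ℕ) :
    Module.length (AdicCompletion I R)
      (AdicCompletion I R ⧸ maximalIdeal (AdicCompletion I R) ^ n) =
      Module.length R (R ⧸ maximalIdeal R ^ n) := by
  rw [maximalIdeal_adicCompletion hI hIM, ← Ideal.map_pow]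
  exact length_quotient_map hI (Ideal.pow_right_mono hIM n)

end IsLocalRing

section Principal

variable {m : R}

theorem mem_span_pow_of_mul_mem (hm : m ∈ nonZeroDivisors R) {n : ℕ} {r : R}
    (h : r * m ∈ Ideal.span {m} ^ (n + 1)) : r ∈ Ideal.span {m} ^ n := by
  rw [Ideal.span_singleton_pow, Ideal.mem_span_singleton] at h ⊢
  rwa [pow_succ, dvd_cancel_right_mem_nonZeroDivisors hm] at h

theorem algebraMap_mem_nonZeroDivisors (hm : m ∈ nonZeroDivisors R) :
    algebraMap R (AdicCompletion (Ideal.span {m}) R) m ∈ nonZeroDivisors _ := by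
  have hfg : (Ideal.span {m}).FG := Submodule.fg_span_singleton m
  refine mem_nonZeroDivisors_iff_right.2 fun x hx => AdicCompletion.ext_evalₐ fun n => ?_
  rw [map_zero, ← RingHom.mem_ker, ker_evalₐ_eq_map hfg]
  obtain ⟨r, hr⟩ := exists_sub_algebraMap_mem_map_pow hfg n x
  have hrm : algebraMap R (AdicCompletion (Ideal.span {m}) R) (r * m) ∈
      (Ideal.span {m} ^ (n + 1)).map (algebraMap R (AdicCompletion (Ideal.span {m}) R)) := by
    have h := Ideal.mul_mem_mul hr
      (Ideal.mem_map_of_mem (algebraMap R (AdicCompletion (Ideal.span {m}) R))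
        (Ideal.mem_span_singleton_self m))
    rwa [← Ideal.map_mul, ← pow_succ, sub_mul, hx, zero_sub, neg_mem_iff, ← map_mul] at h
  rw [algebraMap_mem_map_iff le_rfl] at hrm
  simpa only [sub_add_cancel] using
    add_mem hr (Ideal.mem_map_of_mem (algebraMap R _) (mem_span_pow_of_mul_mem hm hrm))

/-- The isomorphism `R / m R ≃ A / m A`, with `A` the `m`-adic completion of `R`. -/
noncomputable def quotientSpanEquiv (m : R) : (R ⧸ Ideal.span {m}) ≃+*
    (AdicCompletion (Ideal.span {m}) R ⧸
      Ideal.span {algebraMap R (AdicCompletion (Ideal.span {m}) R) m}) :=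
  (quotientMapAlgEquiv (Submodule.fg_span_singleton m)
    (pow_one (Ideal.span {m})).le).toRingEquiv.trans
      (Ideal.quotEquivOfEq (by rw [Ideal.map_span, Set.image_singleton]))

theorem isNoetherianRing_adicCompletion [IsNoetherianRing (R ⧸ Ideal.span {m})] :
    IsNoetherianRing (AdicCompletion (Ideal.span {m}) R) := by
  have hcomplete := AdicCompletion.isAdicComplete_self (Ideal.span {m})
    (Submodule.fg_span_singleton m)
  rw [Ideal.map_span, Set.image_singleton] at hcomplete
  have := isNoetherianRing_of_ringEquiv _ (quotientSpanEquiv m)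
  exact isNoetherianRing_of_isAdicComplete_span_singleton (algebraMap R _ m)

theorem ringKrullDim_adicCompletion [IsLocalRing R] (hmM : m ∈ maximalIdeal R)
    (hm : m ∈ nonZeroDivisors R) [IsLocalRing (AdicCompletion (Ideal.span {m}) R)]
    [IsNoetherianRing (AdicCompletion (Ideal.span {m}) R)] :
    ringKrullDim (AdicCompletion (Ideal.span {m}) R) =
      ringKrullDim (R ⧸ Ideal.span {m}) + 1 := by
  have hmA : algebraMap R (AdicCompletion (Ideal.span {m}) R) m ∈ maximalIdeal _ := by
    rw [maximalIdeal_adicCompletion (Submodule.fg_span_singleton m)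
      ((Ideal.span_singleton_le_iff_mem _).2 hmM)]
    exact Ideal.mem_map_of_mem _ hmM
  rw [← ringKrullDim_quotient_span_singleton_succ_eq_ringKrullDim_of_mem_nonZeroDivisors
    (algebraMap_mem_nonZeroDivisors hm) hmA, ringKrullDim_eq_of_ringEquiv (quotientSpanEquiv m)]

end Principal

end Completion

section Multiplicity

variable {R : Type*} [CommRing R] [IsLocalRing R]

theorem hasMultiplicity_of_length_pow_add (hdim : ringKrullDim R = 1) {a e n : ℕ} (he : e ≠ 0)
    (h : ∀ i : ℕ, Module.length R (R ⧸ maximalIdeal R ^ (n + i)) = a + i * e) :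
    HasMultiplicity R e := by
  have he' : (e : ℚ) ≠ 0 := Nat.cast_ne_zero.2 he
  refine ⟨1, Polynomial.C (e : ℚ) * Polynomial.X + Polynomial.C ((a : ℚ) - e * n),
    by rw [hdim, Nat.cast_one], Polynomial.natDegree_linear he', ?_,
    by rw [Polynomial.leadingCoeff_linear he', Nat.factorial_one, Nat.cast_one, one_mul]⟩
  filter_upwards [Filter.eventually_ge_atTop n] with j hj
  obtain ⟨i, rfl⟩ := Nat.exists_eq_add_of_le hj
  refine ⟨a + i * e, by rw [h]; norm_cast, ?_⟩
  simp only [Polynomial.eval_add, Polynomial.eval_mul, Polynomial.eval_C, Polynomial.eval_X]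
  push_cast
  ring

theorem exists_length_quotient_maximalIdeal_pow (hM : RegularIdeal (maximalIdeal R)) {k : ℕ}
    (h : TwoGenerated (maximalIdeal R ^ (k + 2))) :
    ∃ a e n : ℕ, e ≠ 0 ∧ e ≤ 2 ∧
      ∀ i : ℕ, Module.length R (R ⧸ maximalIdeal R ^ (n + i)) = a + i * e := by
  obtain ⟨y, hyM, hy, hlen, hpow⟩ := exists_parameter_of_twoGenerated_pow hM h
  have hfin := ne_top_of_le_ne_top (by decide) hlen
  obtain ⟨a, ha⟩ := ENat.ne_top_iff_exists.1
    (length_quotient_ne_top_of_mem_radical hy hfin ⟨k + 1, Ideal.pow_mem_pow hyM _⟩)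
  obtain ⟨e, he⟩ := ENat.ne_top_iff_exists.1 hfin
  refine ⟨a, e, k + 1, ?_, by rw [← he] at hlen; exact_mod_cast hlen, fun i => ?_⟩
  · rintro rfl
    rw [Nat.cast_zero, eq_comm, Module.length_eq_zero_iff, Ideal.Quotient.subsingleton_iff,
      Ideal.span_singleton_eq_top] at he
    exact hyM he
  · rw [length_quotient_pow_add hyM hy hfin hpow, ha, he]

theorem eval_add_one_sub_eval_of_natDegree_eq_one {p : Polynomial ℚ} (hp : p.natDegree = 1)
    (x : ℚ) : p.eval (x + 1) - p.eval x = p.leadingCoeff := by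
  obtain ⟨a, ha, b, rfl⟩ := Polynomial.natDegree_eq_one.1 hp
  rw [Polynomial.leadingCoeff_linear ha]
  simp only [Polynomial.eval_add, Polynomial.eval_mul, Polynomial.eval_C, Polynomial.eval_X]
  ring

theorem twoGenerated_pow_of_length_quotient_le (hM : (maximalIdeal R).FG) {n : ℕ}
    (hfin : Module.length R (R ⧸ maximalIdeal R ^ n) ≠ ⊤)
    (hle : Module.length R (R ⧸ maximalIdeal R ^ (n + 1)) ≤
      2 + Module.length R (R ⧸ maximalIdeal R ^ n)) :
    TwoGenerated (maximalIdeal R ^ n) := by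
  refine twoGenerated_iff_relLength_le.2 ⟨Submodule.FG.pow hM n, ?_⟩
  rwa [← relLength_top, ← relLength_top,
    relLength_eq_add (Ideal.pow_le_pow_right n.le_succ) le_top,
    ENat.add_le_add_iff_right (by rwa [relLength_top]), pow_succ'] at hle

theorem exists_twoGenerated_pow_of_hilbert (hM : (maximalIdeal R).FG) {p : Polynomial ℚ}
    (hp : p.natDegree = 1) (hp2 : p.leadingCoeff ≤ 2)
    (h : ∀ᶠ n : ℕ in Filter.atTop, ∃ l : ℕ,
      Module.length R (R ⧸ maximalIdeal R ^ n) = l ∧ (l : ℚ) = p.eval (n : ℚ)) :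
    ∃ n : ℕ, 2 ≤ n ∧ TwoGenerated (maximalIdeal R ^ n) := by
  obtain ⟨n, ⟨⟨a, ha, hap⟩, b, hb, hbp⟩, hn⟩ :=
    ((h.and ((Filter.tendsto_add_atTop_nat 1).eventually h)).and
      (Filter.eventually_ge_atTop 2)).exists
  refine ⟨n, hn, twoGenerated_pow_of_length_quotient_le hM (ha ▸ ENat.natCast_ne_top a) ?_⟩
  have hsub := eval_add_one_sub_eval_of_natDegree_eq_one hp n
  rw [← Nat.cast_add_one, ← hap, ← hbp] at hsub
  have hab : (b : ℚ) ≤ 2 + a := by linarith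
  rw [ha, hb]
  exact_mod_cast hab

end Multiplicity

section Main

variable {R : Type*} [CommRing R] [IsLocalRing R]
  (hprime : ∀ P : Ideal R, P.IsPrime → RegularIdeal P → P.IsMaximal)
  {m : R} (hmM : m ∈ maximalIdeal R) (hm : m ∈ nonZeroDivisors R)
include hprime hmM hm

theorem ringKrullDim_adicCompletion_eq_one [IsLocalRing (AdicCompletion (Ideal.span {m}) R)]
    [IsNoetherianRing (AdicCompletion (Ideal.span {m}) R)] :
    ringKrullDim (AdicCompletion (Ideal.span {m}) R) = 1 := by
  have hreg : RegularIdeal (Ideal.span {m}) := ⟨m, Ideal.mem_span_singleton_self m, hm⟩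
  have hne : Ideal.span {m} ≠ ⊤ := ne_top_of_le_ne_top Ideal.IsPrime.ne_top'
    ((Ideal.span_singleton_le_iff_mem (maximalIdeal R)).2 hmM)
  rw [ringKrullDim_adicCompletion hmM hm, ringKrullDim_quotient_eq_zero hprime hreg hne, zero_add]

theorem isNoetherianRing_quotient_of_twoGenerated_pow {k : ℕ}
    (h : TwoGenerated (maximalIdeal R ^ (k + 2))) : IsNoetherianRing (R ⧸ Ideal.span {m}) := by
  obtain ⟨y, hyM, hy, hlen, -⟩ := exists_parameter_of_twoGenerated_pow ⟨m, hmM, hm⟩ h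
  have hyrad : y ∈ (Ideal.span {m}).radical :=
    maximalIdeal_le_radical hprime ⟨m, Ideal.mem_span_singleton_self m, hm⟩ hyM
  have hfin := length_quotient_ne_top_of_mem_radical hy (ne_top_of_le_ne_top (by decide) hlen) hyrad
  rw [Module.length_ne_top_iff, isFiniteLength_iff_isNoetherian_isArtinian] at hfin
  have := hfin.1
  exact isNoetherian_of_tower R inferInstance

theorem hasMultiplicity_le_two_of_twoGenerated_pow {k : ℕ}
    (h : TwoGenerated (maximalIdeal R ^ (k + 2))) :
    ∃ _ : IsLocalRing (AdicCompletion (Ideal.span {m}) R),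
      IsNoetherianRing (AdicCompletion (Ideal.span {m}) R) ∧
      ∃ e : ℚ, HasMultiplicity (AdicCompletion (Ideal.span {m}) R) e ∧ e ≤ 2 := by
  have hfg : (Ideal.span {m}).FG := Submodule.fg_span_singleton m
  have hle : Ideal.span {m} ≤ maximalIdeal R := (Ideal.span_singleton_le_iff_mem _).2 hmM
  have hlocal := isLocalRing_adicCompletion hfg hle
  have := isNoetherianRing_quotient_of_twoGenerated_pow hprime hmM hm h
  have hnoeth : IsNoetherianRing (AdicCompletion (Ideal.span {m}) R) :=
    isNoetherianRing_adicCompletion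
  obtain ⟨a, e, n, he0, he2, hlen⟩ := exists_length_quotient_maximalIdeal_pow ⟨m, hmM, hm⟩ h
  refine ⟨hlocal, hnoeth, e, hasMultiplicity_of_length_pow_add (a := a) (n := n)
    (ringKrullDim_adicCompletion_eq_one hprime hmM hm) he0 fun i => ?_, by exact_mod_cast he2⟩
  rw [length_quotient_maximalIdeal_pow_adicCompletion hfg hle, hlen]

theorem exists_twoGenerated_pow_of_hasMultiplicity
    [IsLocalRing (AdicCompletion (Ideal.span {m}) R)]
    [IsNoetherianRing (AdicCompletion (Ideal.span {m}) R)] {e : ℚ}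
    (h : HasMultiplicity (AdicCompletion (Ideal.span {m}) R) e) (he : e ≤ 2) :
    ∃ n : ℕ, 2 ≤ n ∧ TwoGenerated (maximalIdeal R ^ n) := by
  obtain ⟨d, p, hd, hpd, hlen, rfl⟩ := h
  rw [ringKrullDim_adicCompletion_eq_one hprime hmM hm] at hd
  obtain rfl : d = 1 := by exact_mod_cast hd.symm
  rw [Nat.factorial_one, Nat.cast_one, one_mul] at he
  simp only [length_quotient_maximalIdeal_pow_adicCompletion (Submodule.fg_span_singleton m)
    ((Ideal.span_singleton_le_iff_mem _).2 hmM)] at hlen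
  have : IsNoetherianRing (R ⧸ Ideal.span {m}) :=
    isNoetherianRing_of_ringEquiv _ (quotientSpanEquiv m).symm
  exact exists_twoGenerated_pow_of_hilbert (fg_of_mem_of_isNoetherianRing_quotient hmM) hpd he hlen

end Main

theorem theorem5p4_general {R : Type*} [CommRing R] [IsLocalRing R]
    (hprime : ∀ P : Ideal R, P.IsPrime → RegularIdeal P → P.IsMaximal)
    (m : R) (hmM : m ∈ maximalIdeal R) (hm : m ∈ nonZeroDivisors R) :
    List.TFAE [
      ∃ n : ℕ, 2 ≤ n ∧ TwoGenerated (maximalIdeal R ^ n),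
      ∃ _ : IsLocalRing (AdicCompletion (Ideal.span {m}) R),
        IsNoetherianRing (AdicCompletion (Ideal.span {m}) R) ∧
        ∃ e : ℚ, HasMultiplicity (AdicCompletion (Ideal.span {m}) R) e ∧ e ≤ 2,
      ∀ I : Ideal R, RegularIdeal I → TwoGenerated I] := by
  tfae_have 1 → 3 := by
    rintro ⟨n, hn, h⟩ I hI
    obtain ⟨k, rfl⟩ := Nat.exists_eq_add_of_le' hn
    exact twoGenerated_of_twoGenerated_pow hprime ⟨m, hmM, hm⟩ h hI
  tfae_have 3 → 1 := fun h => ⟨2, le_rfl, h _ ⟨m ^ 2, Ideal.pow_mem_pow hmM 2, pow_mem hm 2⟩⟩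
  tfae_have 1 → 2 := by
    rintro ⟨n, hn, h⟩
    obtain ⟨k, rfl⟩ := Nat.exists_eq_add_of_le' hn
    exact hasMultiplicity_le_two_of_twoGenerated_pow hprime hmM hm h
  tfae_have 2 → 1 := fun ⟨_, _, _, h, he⟩ =>
    exists_twoGenerated_pow_of_hasMultiplicity hprime hmM hm h he
  tfae_finish

theorem theorem5p4 {R : Type*} [CommRing R] [IsLocalRing R]
    (hdim : ringKrullDim R = 1)
    (m : R) (hmM : m ∈ IsLocalRing.maximalIdeal R) (hm : m ∈ nonZeroDivisors R) :
    List.TFAE [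
      ∃ n : ℕ, 2 ≤ n ∧ TwoGenerated (IsLocalRing.maximalIdeal R ^ n),
      ∃ _ : IsLocalRing (AdicCompletion (Ideal.span {m}) R),
        IsNoetherianRing (AdicCompletion (Ideal.span {m}) R) ∧
        ∃ e : ℚ, HasMultiplicity (AdicCompletion (Ideal.span {m}) R) e ∧ e ≤ 2,
      ∀ I : Ideal R, RegularIdeal I → TwoGenerated I] :=
  have : Ring.KrullDimLE 1 R := Ring.krullDimLE_iff.2 hdim.le
  theorem5p4_general (fun _ _ => isMaximal_of_regularIdeal) m hmM hm
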